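/- **Setting.** Let $\theta=\pi/5$. The Penrose rhombs have sides of length $1$: the thin rhomb $ABCD$ (corners in counterclockwise order) has angle $\theta$ at $A,C$ and $4\theta$ at $B,D$; the thick rhomb $EFGH$ (counterclockwise) has angle $2\theta$ at $E,G$ and $3\theta$ at $F,H$. Their edges carry arrows of two kinds: double arrows $A\to B$, $C\to B$, $E\to F$, $E\to H$ and single arrows $D\to C$, $D\to A$, $G\to F$, $G\to H$. A Penrose tiling $\mathcal P$ is a tiling of the plane by congruent copies of these two marked rhombs, edge to edge, such that on each common edge the kinds and the directions of the arrows of the two rhombs agree. Choose a point $Q$ in the interior of the triangle $ABD$ (the half of the thin rhomb at $A$) and copy it into each thin rhomb of $\mathcal P$. In each thick rhomb let $R$ and $S$ be the points such that the triangles $EFR$ and $GHS$ are the images of the triangles $ABQ$ and $DAQ$ under the orientation-preserving isometries with $A\mapsto E$, $B\mapsto F$ and with $D\mapsto G$, $A\mapsto H$, respectively. Draw the segments $QA,QB,QD$ in each thin rhomb and $RE,RF,SG,SH,RS$ in each thick rhomb, and erase all edges of $\mathcal P$. The resulting tiling $\mathcal T$ is the *Ammann tiling* obtained from $\mathcal P$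 by recomposition. Its tiles of *type $A$* are those that contain the quadrilateral $HERS$ of a thick rhomb. The *corona* of a tile $T\in\mathcal T$ is the set of all tiles $T'\in\mathcal T$ such that $T\cap T'$ contains at least two distinct points. The *corona atlas* of $\mathcal T$ is the set of all coronas of tiles of $\mathcal T$. A *reduced corona atlas* of $\mathcal T$ is a subset of the corona atlas that covers $\mathcal T$, i.e. such that every tile of $\mathcal T$ belongs to at least one of the coronas in the subset. **Theorem 4.2.** For every Penrose tiling $\mathcal P$ and every such choice of $Q$, the set of coronas of the type $A$ tiles of the Ammann tiling $\mathcal T$ is a reduced corona atlas of $\mathcal T$; in particular, every tile of $\mathcal T$ lies in the corona of some type $A$ tile. -/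

import Mathlib

open Set

noncomputable section

/-! ## General notions for families of tiles in the Euclidean plane `ℂ` -/

/-- The (first) corona of `t` in the family `T`: all tiles of `T` that have at least two distinct
points in common with `t`. -/
def corona (T : Set (Set ℂ)) (t : Set ℂ) : Set (Set ℂ) :=
  {s | s ∈ T ∧ ∃ x y : ℂ, x ∈ t ∩ s ∧ y ∈ t ∩ s ∧ x ≠ y}

/-- The (first) corona atlas: all coronas of tiles of `T`. -/
def coronaAtlas (T : Set (Set ℂ)) : Set (Set (Set ℂ)) :=
  {c | ∃ t ∈ T, c = corona T t}

/-- A reduced corona atlas of `T`: a subset of the corona atlas that covers `T`, i.e. every tile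
of `T` belongs to one of the chosen coronas. -/
def IsReducedCoronaAtlas (T : Set (Set ℂ)) (K : Set (Set (Set ℂ))) : Prop :=
  K ⊆ coronaAtlas T ∧ ∀ s ∈ T, ∃ c ∈ K, s ∈ c

/-! ## Penrose tilings by marked rhombs -/

/-- The unit vector at angle `π / 5`. -/
def zeta : ℂ := Complex.exp ((Real.pi / 5 : ℝ) * Complex.I)

inductive RhombKind
  | thin
  | thick

/-- The two kinds of marks of edges. -/
inductive EdgeMark
  | single
  | double

/-- A marked edge: a segment, directed by an arrow from `tail` to `head`, with a kind of mark. -/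
structure MarkedEdge where
  tail : ℂ
  head : ℂ
  mark : EdgeMark

/-- The Penrose edge as a subset of the plane. -/
def MarkedEdge.carrier (e : MarkedEdge) : Set ℂ := segment ℝ e.tail e.head

/-- A marked Penrose rhomb in the plane: the image of the prototile of its kind under the direct
isometry `z ↦ base + dir * z`. The marked prototiles have a mirror symmetry, so these are all
the congruent copies of them. -/
structure Rhomb where
  kind : RhombKind
  base : ℂ
  dir : ℂ
  norm_dir : ‖dir‖ = 1

namespace Rhomb

/-- The corners of the prototiles, in counterclockwise order. Thin rhomb: `A, B, C, D`, with angle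
`π / 5` at `A`, `C` and `4 π / 5` at `B`, `D`. Thick rhomb: `E, F, G, H`, with angle `2 π / 5`
at `E`, `G` and `3 π / 5` at `F`, `H`. All sides have length one. -/
def protoCorner : RhombKind → Fin 4 → ℂ
  | .thin => ![0, 1, 1 + zeta, zeta]
  | .thick => ![0, 1, 1 + zeta ^ 2, zeta ^ 2]

/-- The isometry that carries the prototile to the rhomb `r`. -/
def place (r : Rhomb) (z : ℂ) : ℂ := r.base + r.dir * z

/-- The corners of `r`: `A, B, C, D` for a thin rhomb and `E, F, G, H` for a thick one. -/
def corner (r : Rhomb) (i : Fin 4) : ℂ := r.place (protoCorner r.kind i)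

/-- The closed region of the plane occupied by `r`. -/
def region (r : Rhomb) : Set ℂ := convexHull ℝ (range r.corner)

/-- The markings (adjacency rules) of the rhombs. Thin rhomb: double arrows `A → B`, `C → B`,
single arrows `D → C`, `D → A`. Thick rhomb: double arrows `E → F`, `E → H`,
single arrows `G → F`, `G → H`. -/
def edges (r : Rhomb) : Set MarkedEdge :=
  match r.kind with
  | .thin =>
    {⟨r.corner 0, r.corner 1, .double⟩, ⟨r.corner 2, r.corner 1, .double⟩,
      ⟨r.corner 3, r.corner 2, .single⟩, ⟨r.corner 3, r.corner 0, .single⟩}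
  | .thick =>
    {⟨r.corner 0, r.corner 1, .double⟩, ⟨r.corner 0, r.corner 3, .double⟩,
      ⟨r.corner 2, r.corner 1, .single⟩, ⟨r.corner 2, r.corner 3, .single⟩}

end Rhomb

/-- A Penrose tiling by rhombs: the marked rhombs cover the plane, have pairwise disjoint
interiors, and fit together edge to edge according to the adjacency rules: each edge of
a rhomb is also an edge, with the same mark and the same arrow, of another rhomb. -/
structure IsPenroseTiling (P : Set Rhomb) : Prop where
  covers : (⋃ r ∈ P, r.region) = univ
  disjoint_interiors : ∀ r ∈ P, ∀ s ∈ P, r ≠ s → Disjoint (interior r.region) (interior s.region)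
  edges_match : ∀ r ∈ P, ∀ e ∈ r.edges, ∃ s ∈ P, s ≠ r ∧ e ∈ s.edges

/-! ## Recomposition -/

/-- The direct similarity of the plane that carries `a` to `a'` and `b` to `b'`
(for `a ≠ b`), applied to `z`. -/
def copyPoint (a b a' b' z : ℂ) : ℂ := a' + (b' - a') / (b - a) * (z - a)

/-- The admissible choices of `Q` in the thin prototile: the points of the open half of the rhomb
at the corner `A`, i.e. the open triangle `A B D`. Their three closest corners
are `A`, `B` and `D`. -/
def IsAdmissible (q : ℂ) : Prop :=
  q ∈ interior (convexHull ℝ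
    {Rhomb.protoCorner .thin 0, Rhomb.protoCorner .thin 1, Rhomb.protoCorner .thin 3})

namespace Rhomb

/-- The point `Q` of a thin rhomb. -/
def pointQ (q : ℂ) (r : Rhomb) : ℂ := r.place q

/-- The point `R` of a thick rhomb: the triangle `A B Q` is copied to `E F R`. -/
def pointR (q : ℂ) (r : Rhomb) : ℂ :=
  r.place (copyPoint (protoCorner .thin 0) (protoCorner .thin 1)
    (protoCorner .thick 0) (protoCorner .thick 1) q)

/-- The point `S` of a thick rhomb: the triangle `D A Q` is copied to `G H S`. -/
def pointS (q : ℂ) (r : Rhomb) : ℂ :=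
  r.place (copyPoint (protoCorner .thin 3) (protoCorner .thin 0)
    (protoCorner .thick 2) (protoCorner .thick 3) q)

/-- The quadrilateral `H E R S` in a thick rhomb; it is convex. -/
def pieceHERS (q : ℂ) (r : Rhomb) : Set ℂ :=
  convexHull ℝ {r.corner 3, r.corner 0, r.pointR q, r.pointS q}

/-- The quadrilateral `F G S R` in a thick rhomb. It need not be convex at `S`,
so it is given as the union of the triangles `F G S` and `F S R`. -/
def pieceFGSR (q : ℂ) (r : Rhomb) : Set ℂ :=
  convexHull ℝ {r.corner 1, r.corner 2, r.pointS q} ∪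
    convexHull ℝ {r.corner 1, r.pointS q, r.pointR q}

/-- The pieces into which the new edges cut a rhomb. The new edges are `QA`, `QB`, `QD` in a thin
rhomb, with pieces `A B Q`, `D A Q` and the convex quadrilateral `Q B C D`; and
`RE`, `RF`, `SG`, `SH`, `RS` in a thick rhomb, with pieces `E F R`, `G H S`, `H E R S`
and `F G S R`. -/
def pieces (q : ℂ) (r : Rhomb) : Set (Set ℂ) :=
  match r.kind with
  | .thin =>
    {convexHull ℝ {r.corner 0, r.corner 1, r.pointQ q},
      convexHull ℝ {r.corner 3, r.corner 0, r.pointQ q},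
      convexHull ℝ {r.pointQ q, r.corner 1, r.corner 2, r.corner 3}}
  | .thick =>
    {convexHull ℝ {r.corner 0, r.corner 1, r.pointR q},
      convexHull ℝ {r.corner 2, r.corner 3, r.pointS q},
      r.pieceHERS q,
      r.pieceFGSR q}

end Rhomb

/-- All the pieces of all rhombs of `P`. -/
def allPieces (q : ℂ) (P : Set Rhomb) : Set (Set ℂ) := {p | ∃ r ∈ P, p ∈ r.pieces q}

/-- Two pieces merge when a Penrose edge that separates them is erased. -/
def Merge (q : ℂ) (P : Set Rhomb) (p p' : Set ℂ) : Prop :=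
  p ∈ allPieces q P ∧ p' ∈ allPieces q P ∧
    ∃ r ∈ P, ∃ e ∈ r.edges, e.carrier ⊆ p ∩ p'

/-- The tile that contains the piece `p` after all Penrose edges have been erased: the union of
all pieces that can be reached from `p` through erased edges. -/
def tileOf (q : ℂ) (P : Set Rhomb) (p : Set ℂ) : Set ℂ :=
  ⋃₀ {p' | p' ∈ allPieces q P ∧ Relation.ReflTransGen (Merge q P) p p'}

/-- The Ammann tiling obtained from the Penrose tiling `P` by recomposition with the point `q`. -/
def ammannTiling (q : ℂ) (P : Set Rhomb) : Set (Set ℂ) :=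
  {t | ∃ p ∈ allPieces q P, t = tileOf q P p}

/-- The tiles of type `A`: the pentagons that contain the quadrilateral `H E R S` of a thick
rhomb. (The tiles of type `C` are the pentagons that contain a quadrilateral `F G S R`, those
of type `B` the hexagons that contain a quadrilateral `Q B C D`.) -/
def typeATiles (q : ℂ) (P : Set Rhomb) : Set (Set ℂ) :=
  {t | ∃ r ∈ P, r.kind = .thick ∧ t = tileOf q P (r.pieceHERS q)}

/-- The set of coronas of the tiles of type `A`. -/
def coronasOfA (q : ℂ) (P : Set Rhomb) : Set (Set (Set ℂ)) :=
  {c | ∃ t ∈ typeATiles q P, c = corona (ammannTiling q P) t}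

end

/-! ## Arithmetic of `zeta` -/

/-! Inside a thick rhomb each piece shares two distinct points with `HERS`
(`exists_ne_mem_pieceHERS`), so a tile containing a piece of a thick rhomb lies in the corona of a
type A tile. It remains to reach a thick rhomb from every piece of a thin rhomb by crossing erased
edges (`reachesThick`). The pieces `ABQ` and `QBCD` have the double edges `AB` and `CB`. Two thin
rhombs cannot share a double edge (`not_thin_thin_double`), so the neighbour there is thick. The
piece `DAQ` has the single edge `DA`; a thin neighbour across it has this edge as its own `DC`,
hence contributes its `QBCD`, from which a thick rhomb is one more step away. -/

theorem zeta_re : zeta.re = Real.cos (Real.pi / 5) := by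
  rw [zeta, Complex.exp_ofReal_mul_I_re]

theorem zeta_im : zeta.im = Real.sin (Real.pi / 5) := by
  rw [zeta, Complex.exp_ofReal_mul_I_im]

theorem norm_zeta : ‖zeta‖ = 1 := by
  rw [zeta, Complex.norm_exp_ofReal_mul_I]

theorem zeta_ne_zero : zeta ≠ 0 := Complex.exp_ne_zero _

theorem zeta_im_pos : 0 < zeta.im := by
  rw [zeta_im]
  exact Real.sin_pos_of_pos_of_lt_pi (by positivity) (by linarith [Real.pi_pos])

theorem zeta_re_eq : zeta.re = Real.goldenRatio / 2 := by
  rw [zeta_re, Real.cos_pi_div_five, Real.goldenRatio]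
  ring

theorem zeta_sq : zeta ^ 2 = Real.goldenRatio * zeta - 1 := by
  have h : zeta.re ^ 2 + zeta.im ^ 2 = 1 := by
    rw [zeta_re, zeta_im]
    exact Real.cos_sq_add_sin_sq _
  have hg : Real.goldenRatio = 2 * zeta.re := by rw [zeta_re_eq]; ring
  apply Complex.ext
  · simp only [sq, Complex.mul_re, Complex.sub_re, Complex.ofReal_re, Complex.ofReal_im,
      Complex.one_re, hg]
    linarith
  · simp only [sq, Complex.mul_im, Complex.sub_im, Complex.ofReal_re, Complex.ofReal_im,
      Complex.one_im, hg]
    ring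

theorem goldenRatio_bounds : 1.6 < Real.goldenRatio ∧ Real.goldenRatio < 1.7 := by
  have h := Real.goldenRatio_sq
  have h0 := Real.goldenRatio_pos
  constructor <;> nlinarith

theorem zeta_sq_im_pos : 0 < (zeta ^ 2).im := by
  have h : (zeta ^ 2).im = Real.goldenRatio * zeta.im := by
    rw [zeta_sq]
    simp
  rw [h]
  exact mul_pos Real.goldenRatio_pos zeta_im_pos

theorem norm_one_sub_zeta_lt : ‖1 - zeta‖ < 1 := by
  have h : zeta.re ^ 2 + zeta.im ^ 2 = 1 := by
    rw [zeta_re, zeta_im]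
    exact Real.cos_sq_add_sin_sq _
  have hre := zeta_re_eq
  have hg := goldenRatio_bounds.1
  have h2 : ‖1 - zeta‖ ^ 2 < 1 := by
    rw [Complex.sq_norm, Complex.normSq_apply]
    simp only [Complex.sub_re, Complex.sub_im, Complex.one_re, Complex.one_im]
    nlinarith
  nlinarith [norm_nonneg (1 - zeta)]

/-! ## Admissible points -/

/-- This and `norm_le` are all that is needed of admissibility: they keep `R` off `E`, `S` off `H`,
and `R` off `S`. -/
theorem IsAdmissible.ne_zero {q : ℂ} (hq : IsAdmissible q) : q ≠ 0 := by
  have hsub : convexHull ℝ {Rhomb.protoCorner .thin 0, Rhomb.protoCorner .thin 1,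
      Rhomb.protoCorner .thin 3} ⊆ {z : ℂ | 0 ≤ z.im} := by
    refine convexHull_min ?_ (convex_halfSpace_im_ge 0)
    rintro z (rfl | rfl | rfl)
    · simp [Rhomb.protoCorner]
    · simp [Rhomb.protoCorner]
    · simpa [Rhomb.protoCorner] using zeta_im_pos.le
  have h := interior_mono hsub hq
  rw [Complex.interior_setOfPred_le_im] at h
  rintro rfl
  simp at h

theorem IsAdmissible.norm_le {q : ℂ} (hq : IsAdmissible q) : ‖q‖ ≤ 1 := by
  have hsub : convexHull ℝ {Rhomb.protoCorner .thin 0, Rhomb.protoCorner .thin 1,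
      Rhomb.protoCorner .thin 3} ⊆ Metric.closedBall (0 : ℂ) 1 := by
    refine convexHull_min ?_ (convex_closedBall 0 1)
    rintro z (rfl | rfl | rfl) <;> simp [Rhomb.protoCorner, norm_zeta]
  simpa using hsub (interior_subset hq)

namespace Rhomb

/-! ## Interiors of rhombs -/

theorem dir_ne_zero (r : Rhomb) : r.dir ≠ 0 := by
  intro h
  simpa [h] using r.norm_dir

theorem place_injective (r : Rhomb) : Function.Injective r.place := by
  intro x y h
  exact mul_left_cancel₀ r.dir_ne_zero (add_left_cancel h)

/-- The side of the prototile from its corner `0` to its corner `3`. -/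
noncomputable def side : RhombKind → ℂ
  | .thin => zeta
  | .thick => zeta ^ 2

theorem side_im_pos (k : RhombKind) : 0 < (side k).im := by
  cases k
  · exact zeta_im_pos
  · exact zeta_sq_im_pos

theorem protoCorner_eq (k : RhombKind) : protoCorner k = ![0, 1, 1 + side k, side k] := by
  cases k <;> rfl

theorem place_mem_region (r : Rhomb) {a b : ℝ} (ha : 0 ≤ a) (ha' : a ≤ 1) (hb : 0 ≤ b)
    (hb' : b ≤ 1) : r.place (a + b * side r.kind) ∈ r.region := by
  have hc : Convex ℝ r.region := convex_convexHull ℝ _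
  have hm (i : Fin 4) : r.corner i ∈ r.region := subset_convexHull ℝ _ (mem_range_self i)
  have h01 := hc (hm 0) (hm 1) (sub_nonneg.2 ha') ha (sub_add_cancel 1 a)
  have h32 := hc (hm 3) (hm 2) (sub_nonneg.2 ha') ha (sub_add_cancel 1 a)
  convert hc h01 h32 (sub_nonneg.2 hb') hb (sub_add_cancel 1 b) using 1
  simp [corner, protoCorner_eq, place]
  ring

theorem place_mem_interior (r : Rhomb) {a b : ℝ} (ha : 0 < a) (ha' : a < 1) (hb : 0 < b)
    (hb' : b < 1) : r.place (a + b * side r.kind) ∈ interior r.region := by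
  set w := side r.kind with hw
  -- `x` and `y` are the oblique coordinates along the two sides; they are continuous, so the open
  -- unit square in them is an open subset of the region.
  have hw0 : w.im ≠ 0 := (side_im_pos r.kind).ne'
  let y : ℂ → ℝ := fun z => ((z - r.base) / r.dir).im / w.im
  let x : ℂ → ℝ := fun z => ((z - r.base) / r.dir).re - y z * w.re
  have hy : Continuous y := by fun_prop
  have hx : Continuous x := by fun_prop
  have hopen : IsOpen {z | 0 < x z ∧ x z < 1 ∧ 0 < y z ∧ y z < 1} :=
    (isOpen_lt continuous_const hx).inter ((isOpen_lt hx continuous_const).inter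
      ((isOpen_lt continuous_const hy).inter (isOpen_lt hy continuous_const)))
  refine interior_maximal (fun z hz => ?_) hopen ?_
  · obtain ⟨h1, h2, h3, h4⟩ := hz
    have h := r.place_mem_region h1.le h2.le h3.le h4.le
    have hz : (x z + y z * w : ℂ) = (z - r.base) / r.dir := by
      apply Complex.ext
      · simp [x]
      · simp [y, hw0]
    rw [← hw, hz, place, mul_div_cancel₀ _ r.dir_ne_zero, add_sub_cancel] at h
    exact h
  · have hz : (r.place (a + b * w) - r.base) / r.dir = a + b * w := by
      rw [place, add_sub_cancel_left, mul_div_cancel_left₀ _ r.dir_ne_zero]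
    have hyz : y (r.place (a + b * w)) = b := by simp [y, hz, hw0]
    have hxz : x (r.place (a + b * w)) = a := by simp [x, hyz, hz]
    simp only [mem_ofPred_eq, hyz, hxz]
    exact ⟨ha, ha', hb, hb'⟩

/-- A direct isometry is determined by the images of two points. This rules out a neighbour that
uses the shared edge in the same role. -/
theorem ext_of_corners {r s : Rhomb} (hk : r.kind = s.kind) {i j : Fin 4}
    (hij : protoCorner r.kind i ≠ protoCorner r.kind j) (hi : r.corner i = s.corner i)
    (hj : r.corner j = s.corner j) : r = s := by
  obtain ⟨k, b, d, hd⟩ := r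
  obtain ⟨k', b', d', hd'⟩ := s
  obtain rfl : k = k' := hk
  simp only [corner, place] at hi hj hij
  have hdd : d = d' := by
    refine mul_right_cancel₀ (sub_ne_zero.2 hij) ?_
    linear_combination hi - hj
  subst hdd
  obtain rfl : b = b' := by linear_combination hi
  rfl

end Rhomb

open Rhomb

/-! ## Double edges of thin rhombs -/

namespace IsPenroseTiling

variable {P : Set Rhomb}

/-- Turns an overlap into one explicit point, given in the oblique coordinates of both rhombs. -/
theorem eq_of_common_point (hP : IsPenroseTiling P) {r s : Rhomb} (hr : r ∈ P) (hs : s ∈ P)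
    {a b c d : ℝ} (ha : 0 < a ∧ a < 1) (hb : 0 < b ∧ b < 1) (hc : 0 < c ∧ c < 1)
    (hd : 0 < d ∧ d < 1)
    (h : r.place (a + b * side r.kind) = s.place (c + d * side s.kind)) : r = s := by
  by_contra hne
  refine Set.disjoint_left.1 (hP.disjoint_interiors r hr s hs hne)
    (r.place_mem_interior ha.1 ha.2 hb.1 hb.2) ?_
  rw [h]
  exact s.place_mem_interior hc.1 hc.2 hd.1 hd.2

/-- Two thin rhombs never share a double edge: the angle `2 π / 5` left at its head
cannot be filled. -/
theorem not_thin_thin_double (hP : IsPenroseTiling P) {r s : Rhomb} (hr : r ∈ P) (hs : s ∈ P)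
    (hrk : r.kind = .thin) (hsk : s.kind = .thin) (h2 : r.corner 2 = s.corner 0)
    (h1 : r.corner 1 = s.corner 1) : False := by
  have hz := zeta_sq
  obtain ⟨hg1, hg2⟩ := goldenRatio_bounds
  have hgs : (Real.goldenRatio : ℂ) ^ 2 = Real.goldenRatio + 1 := by
    exact_mod_cast Real.goldenRatio_sq
  set φ := Real.goldenRatio
  simp only [corner, place, protoCorner_eq, hrk, hsk, side] at h1 h2
  simp at h1 h2
  have hsd : s.dir = -zeta * r.dir := by linear_combination h2 - h1
  -- `r` and `s` each have angle `4π/5` at the common corner `B`; the neighbour `u` of `r` across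
  -- `AB` would have to fit into the remaining `2π/5`.
  obtain ⟨u, hu, hur, he⟩ := hP.edges_match r hr ⟨r.corner 0, r.corner 1, .double⟩
    (by simp [edges, hrk])
  cases huk : u.kind
  · simp [edges, huk] at he
    rcases he with ⟨e0, e1⟩ | ⟨e0, e1⟩
    · exact hur (ext_of_corners (huk.trans hrk.symm)
        (i := 0) (j := 1) (by simp [huk, protoCorner]) e0.symm e1.symm)
    · simp [corner, place, protoCorner_eq, hrk, huk, side] at e0 e1
      have hud : r.dir = -zeta * u.dir := by linear_combination e1 - e0
      -- `u` has angle `4π/5` at `B`, so it overlaps `s` in a wedge of angle `2π/5`; the witness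
      -- lies on its bisector.
      have key := hP.eq_of_common_point hs hu (a := 1 - (φ - 1) / 2) (b := 1 / 2) (c := 1 / 2)
        (d := (φ - 1) / 2) (by constructor <;> linarith) (by norm_num) (by norm_num)
        (by constructor <;> linarith) (by
          simp only [place, hsk, huk, side]
          push_cast
          rw [hsd, ← h2, hud, e0]
          linear_combination u.dir * (zeta / 2 + 1 / 2) * hz)
      rw [key] at hsd
      have h : u.dir * zeta ^ 2 = u.dir * 1 := by linear_combination -hsd + zeta * hud
      have him := zeta_sq_im_pos
      rw [mul_left_cancel₀ u.dir_ne_zero h] at him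
      simp at him
  · simp [edges, huk] at he
    rcases he with ⟨e0, e1⟩ | ⟨e0, e1⟩
    · simp [corner, place, protoCorner_eq, hrk, huk, side] at e0 e1
      have hud : r.dir = u.dir := by linear_combination e1 - e0
      -- `EF` of `u` equals `AB` of `r` with both rhombs on its left, so they overlap.
      refine hur (hP.eq_of_common_point hu hr (a := 3 / 4) (b := 1 / 2) (c := 1 / 4)
        (d := φ / 2) (by norm_num) (by norm_num) (by norm_num)
        (by constructor <;> linarith) ?_)
      simp only [place, hrk, huk, side]
      push_cast
      rw [hud, e0]
      linear_combination u.dir / 2 * hz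
    · simp [corner, place, protoCorner_eq, hrk, huk, side] at e0 e1
      have hud : r.dir = zeta ^ 2 * u.dir := by linear_combination e1 - e0
      -- `u` has angle `3π/5` at `H = B`, exceeding the gap by `π/5`, so it overlaps `s`.
      have key := hP.eq_of_common_point hs hu (a := 1 - φ / 10) (b := 3 / 5) (c := 1 / 2)
        (d := 1 - (φ / 2 - 3 / 5)) (by constructor <;> linarith) (by norm_num) (by norm_num)
        (by constructor <;> linarith) (by
          simp only [place, hsk, huk, side]
          push_cast
          rw [hsd, ← h2, hud, ← e0]
          linear_combination u.dir * (-3 / 5 * zeta ^ 2 - φ / 2 * zeta - 1 / 2) * hz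
            - u.dir * zeta ^ 2 / 2 * hgs)
      simp [key, huk] at hsk

end IsPenroseTiling

/-! ## Merging pieces -/

section

variable {q : ℂ} {P : Set Rhomb}

theorem segment_subset_convexHull_of_mem {s : Set ℂ} {x y : ℂ} (hx : x ∈ s) (hy : y ∈ s) :
    segment ℝ x y ⊆ convexHull ℝ s :=
  (convex_convexHull ℝ s).segment_subset (subset_convexHull ℝ s hx) (subset_convexHull ℝ s hy)

theorem merge_of_edge {r s : Rhomb} (hr : r ∈ P) (hs : s ∈ P) {e : MarkedEdge} (he : e ∈ r.edges)
    {p p' : Set ℂ} (hp : p ∈ r.pieces q) (hp' : p' ∈ s.pieces q) (h : e.carrier ⊆ p)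
    (h' : e.carrier ⊆ p') : Merge q P p p' :=
  ⟨⟨r, hr, hp⟩, ⟨s, hs, hp'⟩, r, hr, e, he, subset_inter h h'⟩

/-- Every edge of a thick rhomb is contained in one of its pieces. -/
theorem exists_piece_of_edge_thick (q : ℂ) {s : Rhomb} (hs : s.kind = .thick) {e : MarkedEdge}
    (he : e ∈ s.edges) : ∃ p ∈ s.pieces q, e.carrier ⊆ p := by
  simp only [edges, hs, mem_insert_iff, mem_singleton_iff] at he
  simp only [pieces, hs]
  rcases he with rfl | rfl | rfl | rfl
  · exact ⟨_, .inl rfl, segment_subset_convexHull_of_mem (by simp) (by simp)⟩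
  · exact ⟨_, .inr (.inr (.inl rfl)), segment_subset_convexHull_of_mem (by simp) (by simp)⟩
  · exact ⟨_, .inr (.inr (.inr rfl)),
      (segment_subset_convexHull_of_mem (by simp) (by simp)).trans subset_union_left⟩
  · exact ⟨_, .inr (.inl rfl), segment_subset_convexHull_of_mem (by simp) (by simp)⟩

/-- A piece reaches a thick rhomb if a piece of a thick rhomb can be reached from it
through erased edges. -/
def ReachesThick (q : ℂ) (P : Set Rhomb) (p : Set ℂ) : Prop :=
  ∃ r ∈ P, r.kind = .thick ∧ ∃ p' ∈ r.pieces q, Relation.ReflTransGen (Merge q P) p p'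

theorem reachesThick_of_edge {r s : Rhomb} (hr : r ∈ P) (hs : s ∈ P) (hsk : s.kind = .thick)
    {e : MarkedEdge} (he : e ∈ r.edges) (hes : e ∈ s.edges) {p : Set ℂ} (hp : p ∈ r.pieces q)
    (h : e.carrier ⊆ p) : ReachesThick q P p := by
  obtain ⟨p', hp', h'⟩ := exists_piece_of_edge_thick q hsk hes
  exact ⟨s, hs, hsk, p', hp', .single (merge_of_edge hr hs he hp hp' h h')⟩

theorem IsPenroseTiling.reachesThick_QBCD (hP : IsPenroseTiling P) {r : Rhomb} (hr : r ∈ P)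
    (hrk : r.kind = .thin) :
    ReachesThick q P (convexHull ℝ {r.pointQ q, r.corner 1, r.corner 2, r.corner 3}) := by
  have he : ⟨r.corner 2, r.corner 1, .double⟩ ∈ r.edges := by simp [edges, hrk]
  obtain ⟨s, hs, hsr, hes⟩ := hP.edges_match r hr _ he
  cases hsk : s.kind
  · simp [edges, hsk] at hes
    rcases hes with ⟨e0, e1⟩ | ⟨e0, e1⟩
    · exact (hP.not_thin_thin_double hr hs hrk hsk e0 e1).elim
    · exact (hsr (ext_of_corners (hsk.trans hrk.symm) (i := 2) (j := 1)
        (by simp [hsk, protoCorner, zeta_ne_zero]) e0.symm e1.symm)).elim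
  · exact reachesThick_of_edge hr hs hsk he hes (by simp [pieces, hrk])
      (segment_subset_convexHull_of_mem (by simp) (by simp))

theorem IsPenroseTiling.reachesThick (hP : IsPenroseTiling P) {p : Set ℂ}
    (hp : p ∈ allPieces q P) : ReachesThick q P p := by
  obtain ⟨r, hr, hpr⟩ := hp
  cases hrk : r.kind
  · have hpr' := hpr
    simp only [pieces, hrk, mem_insert_iff, mem_singleton_iff] at hpr'
    rcases hpr' with rfl | rfl | rfl
    · have he : ⟨r.corner 0, r.corner 1, .double⟩ ∈ r.edges := by simp [edges, hrk]
      obtain ⟨s, hs, hsr, hes⟩ := hP.edges_match r hr _ he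
      cases hsk : s.kind
      · simp [edges, hsk] at hes
        rcases hes with ⟨e0, e1⟩ | ⟨e0, e1⟩
        · exact (hsr (ext_of_corners (hsk.trans hrk.symm) (i := 0) (j := 1)
            (by simp [hsk, protoCorner]) e0.symm e1.symm)).elim
        · exact (hP.not_thin_thin_double hs hr hsk hrk e0.symm e1.symm).elim
      · exact reachesThick_of_edge hr hs hsk he hes hpr
          (segment_subset_convexHull_of_mem (by simp) (by simp))
    · have he : ⟨r.corner 3, r.corner 0, .single⟩ ∈ r.edges := by simp [edges, hrk]
      obtain ⟨s, hs, hsr, hes⟩ := hP.edges_match r hr _ he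
      cases hsk : s.kind
      · simp [edges, hsk] at hes
        rcases hes with ⟨e0, e1⟩ | ⟨e0, e1⟩
        · obtain ⟨t, ht, htk, p', hp', hreach⟩ := hP.reachesThick_QBCD (q := q) hs hsk
          refine ⟨t, ht, htk, p', hp', .head (merge_of_edge hr hs he hpr (by simp [pieces, hsk])
            (segment_subset_convexHull_of_mem (by simp) (by simp)) ?_) hreach⟩
          exact segment_subset_convexHull_of_mem (by simp [e0]) (by simp [e1])
        · exact (hsr (ext_of_corners (hsk.trans hrk.symm) (i := 3) (j := 0)
            (by simp [hsk, protoCorner, zeta_ne_zero]) e0.symm e1.symm)).elim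
      · exact reachesThick_of_edge hr hs hsk he hes hpr
          (segment_subset_convexHull_of_mem (by simp) (by simp))
    · exact hP.reachesThick_QBCD hr hrk
  · exact ⟨r, hr, hrk, p, hpr, .refl⟩

/-! ## Pieces of thick rhombs and the quadrilateral `H E R S` -/

theorem IsAdmissible.corner_zero_ne_pointR (hq : IsAdmissible q) {r : Rhomb}
    (hr : r.kind = .thick) : r.corner 0 ≠ r.pointR q := by
  intro h
  apply hq.ne_zero
  have := r.place_injective h
  simpa [hr, protoCorner, copyPoint, eq_comm] using this

theorem IsAdmissible.corner_three_ne_pointS (hq : IsAdmissible q) {r : Rhomb}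
    (hr : r.kind = .thick) : r.corner 3 ≠ r.pointS q := by
  intro h
  apply hq.ne_zero
  have h' := r.place_injective h
  simp [hr, protoCorner, copyPoint] at h'
  have hz := zeta_ne_zero
  field_simp at h'
  linear_combination -h'

theorem IsAdmissible.pointR_ne_pointS (hq : IsAdmissible q) (r : Rhomb) :
    r.pointR q ≠ r.pointS q := by
  intro h
  have h' := r.place_injective h
  simp [protoCorner, copyPoint] at h'
  have hz := zeta_ne_zero
  field_simp at h'
  -- The right side has norm `1`, the left side norm below `1`, since `‖q‖ ≤ 1` and the chord `‖1 -
  -- zeta‖` is less than `1`.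
  have h3 : q * (1 - zeta) = -zeta ^ 3 := by linear_combination -h'
  have hn := congrArg norm h3
  rw [norm_mul, norm_neg, norm_pow, norm_zeta, one_pow] at hn
  nlinarith [hq.norm_le, norm_one_sub_zeta_lt, norm_nonneg q, norm_nonneg (1 - zeta)]

/-- Every piece of a thick rhomb has a side in common with the quadrilateral `H E R S`. -/
theorem IsAdmissible.exists_ne_mem_pieceHERS (hq : IsAdmissible q) {r : Rhomb}
    (hr : r.kind = .thick) {p : Set ℂ} (hp : p ∈ r.pieces q) :
    ∃ x y, x ∈ r.pieceHERS q ∩ p ∧ y ∈ r.pieceHERS q ∩ p ∧ x ≠ y := by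
  have hE : r.corner 0 ∈ r.pieceHERS q := subset_convexHull ℝ _ (by simp)
  have hH : r.corner 3 ∈ r.pieceHERS q := subset_convexHull ℝ _ (by simp)
  have hR : r.pointR q ∈ r.pieceHERS q := subset_convexHull ℝ _ (by simp)
  have hS : r.pointS q ∈ r.pieceHERS q := subset_convexHull ℝ _ (by simp)
  simp only [pieces, hr, mem_insert_iff, mem_singleton_iff] at hp
  rcases hp with rfl | rfl | rfl | rfl
  · exact ⟨_, _, ⟨hE, subset_convexHull ℝ _ (by simp)⟩, ⟨hR, subset_convexHull ℝ _ (by simp)⟩,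
      hq.corner_zero_ne_pointR hr⟩
  · exact ⟨_, _, ⟨hH, subset_convexHull ℝ _ (by simp)⟩, ⟨hS, subset_convexHull ℝ _ (by simp)⟩,
      hq.corner_three_ne_pointS hr⟩
  · exact ⟨_, _, ⟨hE, hE⟩, ⟨hR, hR⟩, hq.corner_zero_ne_pointR hr⟩
  · exact ⟨_, _, ⟨hR, .inr (subset_convexHull ℝ _ (by simp))⟩,
      ⟨hS, .inr (subset_convexHull ℝ _ (by simp))⟩, hq.pointR_ne_pointS r⟩

theorem pieceHERS_mem_allPieces {r : Rhomb} (hr : r ∈ P) (hrk : r.kind = .thick) :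
    r.pieceHERS q ∈ allPieces q P :=
  ⟨r, hr, by simp [pieces, hrk]⟩

end

theorem theorem4p2 (P : Set Rhomb) (hP : IsPenroseTiling P) (q : ℂ) (hq : IsAdmissible q) :
    IsReducedCoronaAtlas (ammannTiling q P) (coronasOfA q P) := by
  constructor
  · rintro c ⟨t, ⟨r, hr, hrk, rfl⟩, rfl⟩
    exact ⟨_, ⟨_, pieceHERS_mem_allPieces hr hrk, rfl⟩, rfl⟩
  · rintro s ⟨p, hp, rfl⟩
    obtain ⟨r, hr, hrk, p', hp', hreach⟩ := hP.reachesThick hp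
    obtain ⟨x, y, hx, hy, hxy⟩ := hq.exists_ne_mem_pieceHERS hrk hp'
    have hA : r.pieceHERS q ⊆ tileOf q P (r.pieceHERS q) :=
      subset_sUnion_of_mem ⟨pieceHERS_mem_allPieces hr hrk, .refl⟩
    have hB : p' ⊆ tileOf q P p := subset_sUnion_of_mem ⟨⟨r, hr, hp'⟩, hreach⟩
    exact ⟨_, ⟨_, ⟨r, hr, hrk, rfl⟩, rfl⟩, ⟨p, hp, rfl⟩, x, y, inter_subset_inter hA hB hx,
      inter_subset_inter hA hB hy, hxy⟩
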